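/- **Theorem (Safe Particle Flow).** Let $\mathcal X\subset\mathbb R^n$ be a bounded measurable set that has an outward unit normal vector $\hat{\mathbf n}(x)$ at every boundary point $x\in\partial\mathcal X$ (that is, near $x$ and outside every thin double cone around the hyperplane through $x$ orthogonal to $\hat{\mathbf n}(x)$, the set $\mathcal X$ agrees with the half space $\{y:\langle y-x,\hat{\mathbf n}(x)\rangle<0\}$; this holds for domains with $C^1$ boundary). Let $g_1,\dots,g_N$ be real functions that are continuously differentiable on $\overline{\mathcal X}$, put $\mathcal S_i=\{x\in\mathcal X: g_i(x)\ge 0\}$, and assume that $\mathcal S=\bigcap_i\mathcal S_i$ (with $\mathcal S=\mathcal X$ if $N=0$) is nonempty. Let $$\mathcal P=\Big\{p\in L^1(\mathcal X): p\ge 0 \text{ a.e.},\ \int_{\mathcal X}p\,dx=1\Big\},\qquad \mathcal P_s=\Big\{p\in\mathcal P:\int_{\mathcal X\setminus\mathcal S}p\,dx=0\Big\},\qquad h_i(p)=-\int_{\mathcal X\setminus\mathcal S_i}g_i\,p\,dx .$$ Let the drift $\phi(x,t)$ be continuous on $\overline{\mathcal X}\times[0,\infty)$ with $\langle\phi(x,t),\hat{\mathbf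 n}(x)\rangle=0$ for all $x\in\partial\mathcal X$, $t\ge 0$. Let $\mathbf x(t)$, $t\ge 0$, be a random process in $\mathbb R^n$ whose sample paths almost surely satisfy $\frac{d\mathbf x(t)}{dt}=\phi(\mathbf x(t),t)$ for all $t\ge 0$, and suppose that $\mathbf x(t)$ has a probability density function $q(\cdot,t)$ on $\mathbb R^n$ for every $t\ge0$, with $q(\cdot,0)\in\mathcal P$. Suppose that for some constant $\alpha_h>0$, $$\int_{\mathcal X\setminus\mathcal S_i}q(x,t)\,\langle\nabla g_i(x),\phi(x,t)\rangle\,dx\ \ge\ \alpha_h\,h_i(q(\cdot,t))\qquad\text{for all } i \text{ and all } t\ge0 .$$ Then: 1. $h_i\ge 0$ on $\mathcal P$ for every $i$, and for $p\in\mathcal P$ one has $h_1(p)=\dots=h_N(p)=0$ if and only if $p\in\mathcal P_s$. 2. If for every $T$ the maps $\phi(\cdot,t)$, $t\in[0,T]$, are Lipschitz on $\overline{\mathcal X}$ with a common constant, then $q(\cdot,t)\in\mathcal P$ for all $t\ge 0$. 3. Whenever $q(\cdot,t)\in\mathcal P$ for all $t\ge0$ (in particular in the situation of part 2), the set $\mathcal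 P_s$ is forward invariant, i.e. $q(\cdot,t_0)\in\mathcal P_s$ implies $q(\cdot,t)\in\mathcal P_s$ for all $t\ge t_0\ge 0$, and it is exponentially stable with respect to the barrier functional: $h_i(q(\cdot,t))\le e^{-\alpha_h(t-t_0)}\,h_i(q(\cdot,t_0))$ for all $i$ and all $t\ge t_0\ge0$. -/

import Mathlib

open MeasureTheory Set Filter Topology

namespace SafeParticleFlow

noncomputable section

/-- The constraint set `S_i = {x ∈ X | g_i(x) ≥ 0}` of one constraint function. -/
def constraintSet {n : ℕ} (X : Set (EuclideanSpace ℝ (Fin n)))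
    (g : EuclideanSpace ℝ (Fin n) → ℝ) : Set (EuclideanSpace ℝ (Fin n)) :=
  {x | x ∈ X ∧ 0 ≤ g x}

/-- The safe set: the intersection (inside `X`) of all the constraint sets. -/
def safeSet {n N : ℕ} (X : Set (EuclideanSpace ℝ (Fin n)))
    (g : Fin N → EuclideanSpace ℝ (Fin n) → ℝ) : Set (EuclideanSpace ℝ (Fin n)) :=
  X ∩ ⋂ i, constraintSet X (g i)

/-- The family of probability densities on `X`: integrable on `X`, nonnegative almost everywhere
on `X`, of total integral one over `X` (all with respect to Lebesgue measure). -/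
def densities {n : ℕ} (X : Set (EuclideanSpace ℝ (Fin n))) :
    Set (EuclideanSpace ℝ (Fin n) → ℝ) :=
  {p | IntegrableOn p X volume ∧ (∀ᵐ y ∂(volume.restrict X), 0 ≤ p y) ∧ ∫ y in X, p y = 1}

/-- The feasible densities: the densities on `X` that carry no mass outside the safe set. -/
def feasibleDensities {n N : ℕ} (X : Set (EuclideanSpace ℝ (Fin n)))
    (g : Fin N → EuclideanSpace ℝ (Fin n) → ℝ) : Set (EuclideanSpace ℝ (Fin n) → ℝ) :=
  {p | p ∈ densities X ∧ ∫ y in X \ safeSet X g, p y = 0}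

/-- One component `h_i(p) = -∫_{X ∖ S_i} g_i p` of the barrier functional. -/
def barrier {n : ℕ} (X : Set (EuclideanSpace ℝ (Fin n)))
    (g : EuclideanSpace ℝ (Fin n) → ℝ) (p : EuclideanSpace ℝ (Fin n) → ℝ) : ℝ :=
  -∫ y in X \ constraintSet X g, g y * p y

/-- `ν` is the outward unit normal vector of `X` at the boundary point `p`: near `p`, the set `X`
agrees with the half space `{y | ⟪y - p, ν⟫ < 0}` outside every thin double cone around the
tangent hyperplane. This holds for the classical normal of a set with `C¹` boundary. -/
def IsOutwardUnitNormal {n : ℕ} (X : Set (EuclideanSpace ℝ (Fin n)))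
    (p ν : EuclideanSpace ℝ (Fin n)) : Prop :=
  ‖ν‖ = 1 ∧ ∀ ε : ℝ, 0 < ε → ∀ᶠ y in 𝓝 p,
    (inner ℝ (y - p) ν < -(ε * ‖y - p‖) → y ∈ X) ∧
    (ε * ‖y - p‖ < inner ℝ (y - p) ν → y ∉ X)

/-- `p` is a probability density function, on `ℝⁿ`, of the random vector `Y`. -/
def IsPDFOf {n : ℕ} {Ω : Type*} [MeasurableSpace Ω] (μ : Measure Ω)
    (Y : Ω → EuclideanSpace ℝ (Fin n)) (p : EuclideanSpace ℝ (Fin n) → ℝ) : Prop :=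
  AEMeasurable Y μ ∧ Integrable p volume ∧ (∀ᵐ y ∂volume, 0 ≤ p y) ∧
    μ.map Y = volume.withDensity (fun y => ENNReal.ofReal (p y))

/-- The random process `x` obeys the particle dynamics `dx/dt = φ(x(t), t)` on `[0, ∞)`: almost
every sample path is a classical solution (with the one-sided derivative at time zero). -/
def IsParticleFlow {n : ℕ} {Ω : Type*} [MeasurableSpace Ω] (μ : Measure Ω)
    (φ : EuclideanSpace ℝ (Fin n) → ℝ → EuclideanSpace ℝ (Fin n))
    (x : ℝ → Ω → EuclideanSpace ℝ (Fin n)) : Prop :=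
  ∀ᵐ ω ∂μ, ∀ t : ℝ, 0 ≤ t →
    HasDerivWithinAt (fun s => x s ω) (φ (x t ω) t) (Ici 0) t

end

end SafeParticleFlow

/-! Everything is pathwise: since `x t` has density `q t`, the barrier `h_i(q t)` is the expectation
of the negative part `max (-g_i (x t)) 0`, so no continuity equation or smoothness of `q` is needed.
Decay: along paths this negative part is Lipschitz in time, uniformly over paths, so dominated
convergence differentiates the expectation. The kink at `g_i = 0` does no harm: almost everywhere on
the zero set of `g_i` the derivative of `g_i` vanishes, and the law of `x t` is absolutely
continuous. The boundary is a null set, so the full gradient and the derivative within the closure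
give the same integral. The barrier condition and Grönwall then yield the exponential bound
(`hasDerivWithinAt_barrier`, `barrier_le_exp_mul`), and invariance is the case of initial value
zero. Staying in `X`: a path starting in the interior cannot reach the complement of the interior,
because backward in time its squared distance to that set obeys a Grönwall inequality
(`mem_interior_of_flow`). Tangency enters at the nearest point, where an interior ball touches the
boundary. -/

namespace SafeParticleFlow

/-! ### Geometry of sets with outward normals -/

/-- The boundary of a set with normal vectors at all boundary points is a null set. -/
theorem volume_frontier_eq_zero {n : ℕ} {X : Set (EuclideanSpace ℝ (Fin n))}
    (hX : ∀ y ∈ frontier X, ∃ ν, IsOutwardUnitNormal X y ν) : volume (frontier X) = 0 := by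
  -- Lebesgue density, with balls allowed off centre: the factor 2 admits balls of radius `δ`
  -- centred at distance `2 * δ` from `p`. Placed along `ν`, they lie in the outer cone and miss the
  -- frontier, so the density is 0 rather than 1.
  have hae := IsUnifLocDoublingMeasure.ae_tendsto_measure_inter_div
    (volume : Measure (EuclideanSpace ℝ (Fin n))) (frontier X) 2
  rw [ae_restrict_iff' isClosed_frontier.measurableSet] at hae
  refine measure_eq_zero_iff_ae_notMem.mpr ?_
  filter_upwards [hae] with p h hp
  obtain ⟨ν, hν, hcone⟩ := hX p hp
  have hlim := h hp (fun δ : ℝ => p + (2 * δ) • ν) (fun δ => δ) (l := 𝓝[>] 0) tendsto_id (by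
    filter_upwards [self_mem_nhdsWithin] with δ hδ
    have hδ : (0 : ℝ) < δ := hδ
    simp [Metric.mem_closedBall, dist_eq_norm, norm_smul, hν, abs_of_pos hδ])
  obtain ⟨r, hr, hball⟩ := Metric.eventually_nhds_iff_ball.mp (hcone (1 / 4) (by norm_num))
  have hzero : ∀ᶠ δ : ℝ in 𝓝[>] 0,
      volume (frontier X ∩ Metric.closedBall (p + (2 * δ) • ν) δ) /
        volume (Metric.closedBall (p + (2 * δ) • ν) δ) = 0 := by
    filter_upwards [Ioo_mem_nhdsGT (show (0 : ℝ) < r / 4 by positivity)] with δ hδ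
    suffices frontier X ∩ Metric.closedBall (p + (2 * δ) • ν) δ = ∅ by simp [this]
    refine eq_empty_of_forall_notMem fun y ⟨hyF, hy⟩ => ?_
    rw [Metric.mem_closedBall, dist_eq_norm] at hy
    have hdec : y - p = (y - (p + (2 * δ) • ν)) + (2 * δ) • ν := by module
    have hnorm : ‖y - p‖ ≤ 3 * δ := by
      rw [hdec]
      refine (norm_add_le _ _).trans ?_
      rw [norm_smul, hν, Real.norm_of_nonneg (by linarith [hδ.1])]
      linarith
    have hinner : δ ≤ inner ℝ (y - p) ν := by
      rw [hdec, inner_add_left, inner_smul_left, real_inner_self_eq_norm_sq, hν]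
      have hCS := abs_real_inner_le_norm (y - (p + (2 * δ) • ν)) ν
      rw [hν, mul_one] at hCS
      have := abs_le.mp (hCS.trans hy)
      simp only [conj_trivial]
      linarith [this.1]
    have hopen : IsOpen {z : EuclideanSpace ℝ (Fin n) | 1 / 4 * ‖z - p‖ < inner ℝ (z - p) ν} :=
      isOpen_lt (by fun_prop) (by fun_prop)
    have hmem : y ∈ Metric.ball p r ∩ {z | 1 / 4 * ‖z - p‖ < inner ℝ (z - p) ν} := by
      refine ⟨?_, ?_⟩
      · rw [Metric.mem_ball, dist_eq_norm]; linarith [hδ.2]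
      · simp only [mem_ofPred_eq]; linarith [hδ.1]
    obtain ⟨z, ⟨hz1, hz2⟩, hzX⟩ :=
      mem_closure_iff.mp (frontier_subset_closure hyF) _ (Metric.isOpen_ball.inter hopen) hmem
    exact (hball z hz1).2 hz2 hzX
  exact zero_ne_one (tendsto_nhds_unique (tendsto_const_nhds.congr' (hzero.mono fun _ h => h.symm))
    hlim)

/-- Inward directions point into a set that has an outward normal. -/
theorem mem_span_tangentConeAt_of_inner_neg {n : ℕ} {X : Set (EuclideanSpace ℝ (Fin n))}
    {p ν v : EuclideanSpace ℝ (Fin n)} (hν : IsOutwardUnitNormal X p ν) (hp : p ∈ closure X)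
    (hv : inner ℝ v ν < 0) : v ∈ Submodule.span ℝ (tangentConeAt ℝ (closure X) p) := by
  have hv0 : 0 < ‖v‖ := norm_pos_iff.mpr (by rintro rfl; simp at hv)
  -- Half of `-⟪v, ν⟫ / ‖v‖` as aperture makes the cone condition strict along the ray from `p` in
  -- direction `v`.
  obtain ⟨r, hr, hball⟩ := Metric.eventually_nhds_iff_ball.mp
    (hν.2 (-inner ℝ v ν / (2 * ‖v‖)) (by apply div_pos <;> linarith))
  have hs : 0 < r / (2 * ‖v‖) := by positivity
  have hseg : segment ℝ p (p + (r / (2 * ‖v‖)) • v) ⊆ closure X := by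
    rw [segment_eq_image']
    rintro _ ⟨θ, hθ, rfl⟩
    rcases hθ.1.eq_or_lt with rfl | hθ0
    · simpa using hp
    refine subset_closure ?_
    simp only [add_sub_cancel_left, smul_smul]
    have hc : 0 < θ * (r / (2 * ‖v‖)) := by positivity
    refine (hball _ ?_).1 ?_
    · rw [Metric.mem_ball, dist_eq_norm, add_sub_cancel_left, norm_smul, Real.norm_of_nonneg hc.le]
      calc θ * (r / (2 * ‖v‖)) * ‖v‖ = θ * (r / 2) := by field_simp
        _ ≤ 1 * (r / 2) := by gcongr; exact hθ.2
        _ < r := by linarith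
    · rw [add_sub_cancel_left, norm_smul, Real.norm_of_nonneg hc.le, inner_smul_left]
      have : -inner ℝ v ν / (2 * ‖v‖) * (θ * (r / (2 * ‖v‖)) * ‖v‖)
          = -(θ * (r / (2 * ‖v‖)) * inner ℝ v ν) / 2 := by field_simp
      rw [this]
      simp only [conj_trivial]
      nlinarith [mul_neg_of_pos_of_neg hc hv]
  have hmem := Submodule.subset_span (R := ℝ) (mem_tangentConeAt_of_segment_subset hseg)
  rw [add_sub_cancel_left] at hmem
  exact (Submodule.smul_mem_iff _ hs.ne').mp hmem

/-- The inward directions form an open half space, which spans. This makes `fderivWithin` on the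
closure continuous up to the boundary. -/
theorem uniqueDiffOn_closure {n : ℕ} {X : Set (EuclideanSpace ℝ (Fin n))}
    (hX : ∀ y ∈ frontier X, ∃ ν, IsOutwardUnitNormal X y ν) : UniqueDiffOn ℝ (closure X) := by
  intro p hp
  by_cases hpi : p ∈ interior X
  · exact uniqueDiffWithinAt_of_mem_nhds
      (mem_of_superset (mem_interior_iff_mem_nhds.mp hpi) subset_closure)
  obtain ⟨ν, hν⟩ := hX p ⟨hp, hpi⟩
  refine ⟨?_, subset_closure hp⟩
  suffices Submodule.span ℝ (tangentConeAt ℝ (closure X) p) = ⊤ by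
    rw [this]
    exact dense_univ
  refine eq_top_iff.mpr fun w _ => ?_
  have hw : w = (w - (|inner ℝ w ν| + 1) • ν) - (-(|inner ℝ w ν| + 1)) • ν := by module
  have hself : inner ℝ ν ν = (1 : ℝ) := by rw [real_inner_self_eq_norm_sq, hν.1]; norm_num
  rw [hw]
  refine Submodule.sub_mem _ (mem_span_tangentConeAt_of_inner_neg hν hp ?_)
    (mem_span_tangentConeAt_of_inner_neg hν hp ?_)
  · simp only [inner_sub_left, inner_smul_left, hself, conj_trivial]
    linarith [le_abs_self (inner ℝ w ν : ℝ)]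
  · simp only [inner_smul_left, hself, conj_trivial]
    linarith [abs_nonneg (inner ℝ w ν : ℝ)]

/-! ### Derivatives on zero sets -/

/-- The gradient vanishes almost everywhere on a level set. -/
theorem ae_fderiv_eq_zero_of_zero_set {E : Type*} [NormedAddCommGroup E] [NormedSpace ℝ E]
    [FiniteDimensional ℝ E] [MeasurableSpace E] [BorelSpace E] (μ : Measure E)
    [μ.IsAddHaarMeasure] {f : E → ℝ} {f' : E → E →L[ℝ] ℝ} {Z : Set E} (hZ : MeasurableSet Z)
    (hf : ∀ y ∈ Z, f y = 0) (hf' : ∀ y ∈ Z, HasFDerivWithinAt f (f' y) Z y) :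
    ∀ᵐ y ∂μ, y ∈ Z → f' y = 0 := by
  rw [← ae_restrict_iff' hZ]
  rcases subsingleton_or_nontrivial E with hE | hE
  · exact ae_of_all _ fun y => Subsingleton.elim _ _
  -- Multiplying by a fixed vector turns `f` into a map `E → E`. On `Z` it is approximated by the
  -- zero map with error constant 0, which forces its derivative to vanish almost everywhere there.
  obtain ⟨e, he⟩ := exists_ne (0 : E)
  have happ : ApproximatesLinearOn (fun y => f y • e) (0 : E →L[ℝ] E) Z 0 := by
    intro a ha b hb
    simp [hf a ha, hf b hb]
  filter_upwards [happ.norm_fderiv_sub_le μ hZ (fun y => (f' y).smulRight e)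
    fun y hy => (hf' y hy).smul_const e] with y hy
  simpa [he] using hy

/-! ### Invariance of the interior -/

/-- A vector tangent to the boundary is orthogonal to the radius of an interior ball that touches
the boundary. -/
theorem inner_eq_zero_of_ball_subset {n : ℕ} {X : Set (EuclideanSpace ℝ (Fin n))}
    {z c ν u : EuclideanSpace ℝ (Fin n)} (hν : IsOutwardUnitNormal X c ν)
    (hball : Metric.ball z (dist z c) ⊆ X) (hu : inner ℝ u ν = (0 : ℝ)) :
    inner ℝ (z - c) u = (0 : ℝ) := by
  have hself : inner ℝ ν ν = (1 : ℝ) := by rw [real_inner_self_eq_norm_sq, hν.1]; norm_num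
  -- If `v` pointed both out of `X` and into the ball, the points `c + s • v` with small `s` would
  -- lie in the ball, hence in `X`, and also in the outer cone. The ball contains them for `0 < s <
  -- 2⟪z - c, v⟫ / ‖v‖²`.
  have hhalf : ∀ v, 0 < inner ℝ v ν → inner ℝ (z - c) v ≤ (0 : ℝ) := by
    intro v hv
    by_contra! hneg
    have hv0 : 0 < ‖v‖ := norm_pos_iff.mpr (by rintro rfl; simp at hv)
    have hlim : Tendsto (fun s : ℝ => c + s • v) (𝓝[>] 0) (𝓝 c) := by
      have : Tendsto (fun s : ℝ => c + s • v) (𝓝 0) (𝓝 (c + (0 : ℝ) • v)) :=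
        Continuous.tendsto (by fun_prop) 0
      rw [zero_smul, add_zero] at this
      exact this.mono_left nhdsWithin_le_nhds
    have hev := hlim.eventually
      (hν.2 (inner ℝ v ν / (2 * ‖v‖)) (by positivity))
    have hsmall : ∀ᶠ s : ℝ in 𝓝[>] 0, s ∈ Ioo 0 (2 * inner ℝ (z - c) v / ‖v‖ ^ 2) :=
      Ioo_mem_nhdsGT (by positivity)
    obtain ⟨s, hs1, hs2⟩ := (hev.and hsmall).exists
    refine hs1.2 ?_ (hball ?_)
    · rw [add_sub_cancel_left, norm_smul, Real.norm_of_nonneg hs2.1.le, inner_smul_left]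
      have : inner ℝ v ν / (2 * ‖v‖) * (s * ‖v‖) = s * inner ℝ v ν / 2 := by field_simp
      rw [this]
      simp only [conj_trivial]
      linarith [mul_pos hs2.1 hv]
    · rw [Metric.mem_ball, dist_comm, dist_eq_norm, dist_eq_norm]
      refine lt_of_pow_lt_pow_left₀ 2 (norm_nonneg _) ?_
      have : z - (c + s • v) = (z - c) - s • v := by module
      rw [this, norm_sub_sq_real, inner_smul_right, norm_smul, Real.norm_of_nonneg hs2.1.le]
      have h2 : s * ‖v‖ ^ 2 < 2 * inner ℝ (z - c) v := (lt_div_iff₀ (by positivity)).mp hs2.2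
      nlinarith [mul_lt_mul_of_pos_left h2 hs2.1]
  -- Tangent vectors are limits of the outward vectors `w + η • ν`; applying this to `u` and `-u`
  -- gives equality.
  have hlin : ∀ w, inner ℝ w ν = (0 : ℝ) → inner ℝ (z - c) w ≤ (0 : ℝ) := by
    intro w hw
    have key : ∀ η : ℝ, 0 < η → inner ℝ (z - c) w + η * inner ℝ (z - c) ν ≤ 0 := by
      intro η hη
      have := hhalf (w + η • ν) (by
        simp only [inner_add_left, inner_smul_left, hw, hself, conj_trivial]; linarith)
      rwa [inner_add_right, inner_smul_right] at this
    have hlim : Tendsto (fun η : ℝ => inner ℝ (z - c) w + η * inner ℝ (z - c) ν) (𝓝[>] 0)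
        (𝓝 (inner ℝ (z - c) w + 0 * inner ℝ (z - c) ν)) :=
      (Continuous.tendsto (by fun_prop) 0).mono_left nhdsWithin_le_nhds
    rw [zero_mul, add_zero] at hlim
    exact le_of_tendsto hlim (eventually_mem_nhdsWithin.mono key)
  refine le_antisymm (hlin u hu) ?_
  have := hlin (-u) (by rw [inner_neg_left, hu, neg_zero])
  rw [inner_neg_right] at this
  linarith

/-- A solution of a Lipschitz flow tangent to the boundary stays in the interior of the state
space once it starts there. -/
theorem mem_interior_of_flow {n : ℕ} {X : Set (EuclideanSpace ℝ (Fin n))}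
    (hX : ∀ y ∈ frontier X, ∃ ν, IsOutwardUnitNormal X y ν)
    {φ : EuclideanSpace ℝ (Fin n) → ℝ → EuclideanSpace ℝ (Fin n)}
    (hφ : ∀ t : ℝ, 0 ≤ t → ∀ y ∈ frontier X, ∀ ν,
      IsOutwardUnitNormal X y ν → inner ℝ (φ y t) ν = 0)
    (hL : ∀ T : ℝ, ∃ L : NNReal, ∀ t ∈ Icc 0 T, LipschitzOnWith L (fun y => φ y t) (closure X))
    {y : ℝ → EuclideanSpace ℝ (Fin n)}
    (hy : ∀ t : ℝ, 0 ≤ t → HasDerivWithinAt y (φ (y t) t) (Ici 0) t)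
    (hy0 : y 0 ∈ interior X) {t : ℝ} (ht : 0 ≤ t) : y t ∈ interior X := by
  by_contra hout
  have hcont : ContinuousOn y (Ici 0) := fun s hs => (hy s hs).continuousWithinAt
  set C : Set (EuclideanSpace ℝ (Fin n)) := (interior X)ᶜ with hC
  have hCc : IsClosed C := isOpen_interior.isClosed_compl
  have hCne : C.Nonempty := ⟨y t, hout⟩
  set A : Set ℝ := Ici 0 ∩ y ⁻¹' C
  have hAc : IsClosed A := hcont.preimage_isClosed_of_isClosed isClosed_Ici hCc
  have hAbdd : BddBelow A := ⟨0, fun s hs => hs.1⟩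
  have hmem : sInf A ∈ A := hAc.csInf_mem ⟨t, ht, hout⟩ hAbdd
  set T := sInf A
  have hT0 : 0 ≤ T := hmem.1
  obtain ⟨L, hL⟩ := hL T
  -- Time runs backward from `T`, where the path lies in `C` and `f` vanishes; Grönwall carries this
  -- zero to `s = T`, that is, to the starting point.
  set f : ℝ → ℝ := fun s => Metric.infDist (y (T - s)) C ^ 2 with hf
  have hfcont : ContinuousOn f (Icc 0 T) := by
    refine ((Metric.continuous_infDist_pt C).comp_continuousOn (hcont.comp (by fun_prop) ?_)).pow 2
    intro s hs
    simpa using hs.2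
  have hgron := le_gronwallBound_of_liminf_deriv_right_le (f := f)
    (f' := fun s => 2 * L * f s) (δ := 0) (K := 2 * L) (ε := 0) hfcont ?_ ?_ ?_ T ⟨hT0, le_rfl⟩
  · simp only [gronwallBound_ε0, zero_mul, hf, sub_self] at hgron
    have hd : Metric.infDist (y 0) C = 0 := pow_eq_zero_iff two_ne_zero |>.mp
      (le_antisymm hgron (sq_nonneg _))
    exact (hCc.mem_iff_infDist_zero hCne).mpr hd hy0
  · intro s hs r hr
    have hTs : 0 < T - s := by linarith [hs.2]
    -- With the nearest point `c` frozen, the smooth function `‖y (T - z) - c‖ ^ 2` dominates `f`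
    -- and equals it at `z = s`, so it bounds the right slopes of `f`.
    obtain ⟨c, hcC, hc⟩ := hCc.exists_infDist_eq_dist hCne (y (T - s))
    have hderiv : HasDerivAt y (φ (y (T - s)) (T - s)) (T - s) :=
      (hy _ hTs.le).hasDerivAt (Ici_mem_nhds hTs)
    have hcomp : HasDerivAt (fun z => ‖y (T - z) - c‖ ^ 2)
        (2 * inner ℝ (y (T - s) - c) (-φ (y (T - s)) (T - s))) s := by
      have h1 := (hderiv.scomp s ((hasDerivAt_id s).const_sub T)).sub_const c
      simpa using h1.norm_sq
    have hbound : 2 * inner ℝ (y (T - s) - c) (-φ (y (T - s)) (T - s)) ≤ 2 * L * f s := by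
      simp only [hf]
      rw [hc, dist_eq_norm]
      by_cases hyc : y (T - s) = c
      · simp [hyc]
      have hyint : y (T - s) ∈ interior X := by
        by_contra h
        have h0 := Metric.infDist_zero_of_mem (show y (T - s) ∈ C from h)
        rw [hc, dist_eq_zero] at h0
        exact hyc h0
      have hball : Metric.ball (y (T - s)) (dist (y (T - s)) c) ⊆ X := by
        rw [← hc]
        refine Subset.trans ?_ interior_subset
        intro z hz
        by_contra h
        have := Metric.infDist_le_dist_of_mem (x := y (T - s)) (show z ∈ C from h)
        rw [Metric.mem_ball, dist_comm] at hz
        linarith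
      have hcF : c ∈ frontier X := by
        refine ⟨?_, hcC⟩
        refine closure_mono hball ?_
        rw [closure_ball _ (dist_ne_zero.mpr hyc), Metric.mem_closedBall, dist_comm]
      obtain ⟨ν, hν⟩ := hX c hcF
      -- As `φ c` is orthogonal to `y (T - s) - c`, only the difference `φ (y (T - s)) - φ c`
      -- contributes, and it is controlled by the Lipschitz constant.
      have horth := inner_eq_zero_of_ball_subset hν hball (hφ _ hTs.le c hcF ν hν)
      have hlip := (hL (T - s) ⟨hTs.le, by linarith [hs.1]⟩).norm_sub_le
        (subset_closure (interior_subset hyint)) hcF.1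
      have hCS := abs_real_inner_le_norm (y (T - s) - c) (φ (y (T - s)) (T - s) - φ c (T - s))
      have hge := (abs_le.mp hCS).1
      rw [inner_sub_right, horth, sub_zero] at hge
      rw [inner_neg_right]
      have := mul_le_mul_of_nonneg_left hlip (norm_nonneg (y (T - s) - c))
      nlinarith
    have hslope := (hcomp.hasDerivWithinAt (s := Ici s)).liminf_right_slope_le
      (hbound.trans_lt hr)
    refine (hslope.and_eventually (Ioo_mem_nhdsGT hs.2)).mono fun z hz => ?_
    refine lt_of_le_of_lt ?_ hz.1
    rw [slope_def_field, div_eq_inv_mul]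
    refine mul_le_mul_of_nonneg_left ?_ (inv_nonneg.mpr (by linarith [hz.2.1]))
    simp only [hf]
    rw [hc, dist_eq_norm]
    have := Metric.infDist_le_dist_of_mem (x := y (T - z)) hcC
    rw [dist_eq_norm] at this
    gcongr
    exact Metric.infDist_nonneg
  · simp only [hf, sub_zero]
    rw [Metric.infDist_zero_of_mem (show y T ∈ C from hmem.2)]
    norm_num
  · intro s _
    simp

/-! ### Random vectors with a density -/

section Densities

variable {n : ℕ} {Ω : Type*} [MeasurableSpace Ω] {μ : Measure Ω}
  {Y : Ω → EuclideanSpace ℝ (Fin n)} {p : EuclideanSpace ℝ (Fin n) → ℝ}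

theorem IsPDFOf.map_absolutelyContinuous (h : IsPDFOf μ Y p) : μ.map Y ≪ volume := by
  rw [h.2.2.2]
  exact withDensity_absolutelyContinuous _ _

theorem IsPDFOf.ae_of_ae (h : IsPDFOf μ Y p) {P : EuclideanSpace ℝ (Fin n) → Prop}
    (hP : ∀ᵐ y, P y) : ∀ᵐ ω ∂μ, P (Y ω) :=
  ae_of_ae_map h.1 (h.map_absolutelyContinuous.ae_le hP)

theorem IsPDFOf.integral_comp (h : IsPDFOf μ Y p) {f : EuclideanSpace ℝ (Fin n) → ℝ}
    (hf : AEStronglyMeasurable f) : ∫ ω, f (Y ω) ∂μ = ∫ y, p y * f y := by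
  rw [← integral_map h.1 (hf.mono_ac h.map_absolutelyContinuous), h.2.2.2,
    integral_withDensity_eq_integral_toReal_smul₀ h.2.1.aemeasurable.ennreal_ofReal
      (ae_of_all _ fun _ => ENNReal.ofReal_lt_top)]
  refine integral_congr_ae ?_
  filter_upwards [h.2.2.1] with y hy
  rw [ENNReal.toReal_ofReal hy, smul_eq_mul]

variable [IsProbabilityMeasure μ] {X : Set (EuclideanSpace ℝ (Fin n))}

theorem IsPDFOf.mem_densities_iff (h : IsPDFOf μ Y p) (hX : MeasurableSet X) :
    p ∈ densities X ↔ ∀ᵐ ω ∂μ, Y ω ∈ X := by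
  have hint : ∫ y in X, p y = μ.real (Y ⁻¹' X) := by
    have h1 := h.integral_comp (f := X.indicator (1 : EuclideanSpace ℝ (Fin n) → ℝ))
      ((measurable_one.indicator hX).aestronglyMeasurable)
    have h2 : ∫ ω, X.indicator (1 : EuclideanSpace ℝ (Fin n) → ℝ) (Y ω) ∂μ = μ.real (Y ⁻¹' X) := by
      rw [← integral_map h.1 (measurable_one.indicator hX).aestronglyMeasurable,
        integral_indicator_one hX, map_measureReal_apply_of_aemeasurable h.1 hX]
    rw [← h2, h1, ← integral_indicator hX]
    refine integral_congr_ae (ae_of_all _ fun y => ?_)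
    by_cases hy : y ∈ X <;> simp [hy]
  have hnull : NullMeasurableSet (Y ⁻¹' X) μ := h.1.nullMeasurableSet_preimage hX
  have hiff : (∀ᵐ ω ∂μ, Y ω ∈ X) ↔ μ.real (Y ⁻¹' X) = 1 := by
    have := prob_compl_eq_zero_iff₀ hnull
    rw [measureReal_def, ENNReal.toReal_eq_one_iff, ← this]
    rfl
  rw [hiff, ← hint]
  exact ⟨fun hp => hp.2.2,
    fun hp => ⟨h.2.1.integrableOn, ae_restrict_of_ae h.2.2.1, hp⟩⟩

end Densities

/-! ### The barrier functional and its zero set -/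

section Barrier

variable {n : ℕ} {X : Set (EuclideanSpace ℝ (Fin n))} {g : EuclideanSpace ℝ (Fin n) → ℝ}

theorem measurableSet_constraintSet (hX : MeasurableSet X) (hg : ContinuousOn g X) :
    MeasurableSet (constraintSet X g) := by
  obtain ⟨u, hu, h⟩ := continuousOn_iff'.mp hg (Iio 0) isOpen_Iio
  have : constraintSet X g = X \ (u ∩ X) := by
    ext y
    have hy := Set.ext_iff.mp h y
    simp only [mem_inter_iff, mem_preimage, mem_Iio] at hy
    simp only [constraintSet, mem_ofPred_eq, Set.mem_sdiff, mem_inter_iff, ← hy, ← not_lt]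
    tauto
  rw [this]
  exact hX.diff (hu.measurableSet.inter hX)

theorem integrableOn_mul_of_mem_densities (hX : MeasurableSet X) (hb : Bornology.IsBounded X)
    (hg : ContinuousOn g (closure X)) {p : EuclideanSpace ℝ (Fin n) → ℝ} (hp : p ∈ densities X) :
    IntegrableOn (fun y => g y * p y) X := by
  obtain ⟨C, hC⟩ := hb.isCompact_closure.exists_bound_of_continuousOn hg
  refine Integrable.bdd_mul (c := C) hp.1
    ((hg.mono subset_closure).aestronglyMeasurable hX) ?_
  rw [ae_restrict_iff' hX]
  exact ae_of_all _ fun y hy => hC y (subset_closure hy)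

theorem barrier_nonneg (hX : MeasurableSet X) (hg : ContinuousOn g X)
    {p : EuclideanSpace ℝ (Fin n) → ℝ} (hp : p ∈ densities X) : 0 ≤ barrier X g p := by
  rw [barrier, ← integral_neg]
  refine setIntegral_nonneg_of_ae_restrict ?_
  rw [EventuallyLE, ae_restrict_iff' (hX.diff (measurableSet_constraintSet hX hg))]
  filter_upwards [(ae_restrict_iff' hX).mp hp.2.1] with y hy hmem
  have hlt : g y < 0 := not_le.mp fun h => hmem.2 ⟨hmem.1, h⟩
  have := hy hmem.1
  simp only [Pi.zero_apply]
  nlinarith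

theorem barrier_eq_zero_iff (hX : MeasurableSet X) (hb : Bornology.IsBounded X)
    (hg : ContinuousOn g (closure X)) {p : EuclideanSpace ℝ (Fin n) → ℝ} (hp : p ∈ densities X) :
    barrier X g p = 0 ↔ ∀ᵐ y, y ∈ X → g y < 0 → p y = 0 := by
  have hgX := hg.mono subset_closure
  have hD := hX.diff (measurableSet_constraintSet hX hgX)
  rw [barrier, ← integral_neg, setIntegral_eq_zero_iff_of_nonneg_ae]
  · rw [EventuallyEq, ae_restrict_iff' hD]
    refine eventually_congr (ae_of_all _ fun y => ?_)
    constructor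
    · intro h hy hlt
      have := h ⟨hy, fun h => not_le.mpr hlt h.2⟩
      simpa [hlt.ne] using this
    · intro h hmem
      have hlt : g y < 0 := not_le.mp fun h => hmem.2 ⟨hmem.1, h⟩
      simp [h hmem.1 hlt]
  · rw [EventuallyLE, ae_restrict_iff' hD]
    filter_upwards [(ae_restrict_iff' hX).mp hp.2.1] with y hy hmem
    have hlt : g y < 0 := not_le.mp fun h => hmem.2 ⟨hmem.1, h⟩
    have := hy hmem.1
    simp only [Pi.zero_apply]
    nlinarith
  · exact ((integrableOn_mul_of_mem_densities hX hb hg hp).mono_set sdiff_subset).neg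

/-- The unsafe part of `X` is the finite union of the sets `{g i < 0}`, so `p` vanishes almost
everywhere on it exactly when it does on each of them. -/
theorem barrier_eq_zero_iff_mem_feasibleDensities {N : ℕ}
    {g : Fin N → EuclideanSpace ℝ (Fin n) → ℝ} (hX : MeasurableSet X)
    (hb : Bornology.IsBounded X) (hg : ∀ i, ContinuousOn (g i) (closure X))
    {p : EuclideanSpace ℝ (Fin n) → ℝ} (hp : p ∈ densities X) :
    (∀ i, barrier X (g i) p = 0) ↔ p ∈ feasibleDensities X g := by
  have hS : MeasurableSet (safeSet X g) := hX.inter (MeasurableSet.iInter fun i =>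
    measurableSet_constraintSet hX ((hg i).mono subset_closure))
  simp only [barrier_eq_zero_iff hX hb (hg _) hp]
  rw [← ae_all_iff, feasibleDensities, mem_ofPred_eq, and_iff_right hp,
    setIntegral_eq_zero_iff_of_nonneg_ae (ae_mono (Measure.restrict_mono sdiff_subset le_rfl) hp.2.1)
      (hp.1.mono_set sdiff_subset), EventuallyEq, ae_restrict_iff' (hX.diff hS)]
  refine eventually_congr (ae_of_all _ fun y => ?_)
  simp only [safeSet, constraintSet, Set.mem_sdiff, mem_inter_iff, mem_iInter, mem_ofPred_eq,
    Pi.zero_apply, not_and, not_forall, and_imp]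
  constructor
  · intro h hy hn
    obtain ⟨i, hi⟩ := hn hy
    exact h i hy (not_le.mp (hi hy))
  · intro h i hy hi
    exact h hy fun _ => ⟨i, fun _ => not_le.mpr hi⟩

end Barrier

/-! ### Negative parts along paths -/

/-- At a zero of `u` the hypothesis `h0` gives `u = o(r - t)`, and the negative part is bounded by
`|u|`, so the kink disappears. -/
theorem hasDerivWithinAt_negPart {u : ℝ → ℝ} {u' t : ℝ} {s : Set ℝ}
    (hu : HasDerivWithinAt u u' s t) (h0 : u t = 0 → u' = 0) :
    HasDerivWithinAt (fun r => max (-u r) 0) (if u t < 0 then -u' else 0) s t := by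
  rcases lt_trichotomy (u t) 0 with h | h | h
  · rw [if_pos h]
    refine hu.neg.congr_of_eventuallyEq ?_ (max_eq_left (by linarith))
    filter_upwards [hu.continuousWithinAt.eventually_lt_const h] with r hr
    exact max_eq_left (by linarith)
  · rw [if_neg h.not_lt]
    rw [h0 h, hasDerivWithinAt_iff_isLittleO] at hu
    rw [hasDerivWithinAt_iff_isLittleO]
    refine (Asymptotics.isBigO_of_le _ fun r => ?_).trans_isLittleO hu
    simp only [h, smul_zero, sub_zero, neg_zero, max_self]
    rw [Real.norm_of_nonneg (le_max_right _ _)]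
    exact max_le (neg_le_abs _) (norm_nonneg _)
  · rw [if_neg h.not_gt]
    refine (hasDerivWithinAt_const t s (0 : ℝ)).congr_of_eventuallyEq ?_
      (max_eq_right (by linarith))
    filter_upwards [hu.continuousWithinAt.eventually_const_lt h] with r hr
    exact max_eq_right (by linarith)

section Paths

variable {n : ℕ} {X : Set (EuclideanSpace ℝ (Fin n))} {g : EuclideanSpace ℝ (Fin n) → ℝ}
  {φ : EuclideanSpace ℝ (Fin n) → ℝ → EuclideanSpace ℝ (Fin n)}

theorem hasDerivWithinAt_comp_path (hg : ContDiffOn ℝ 1 g (closure X))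
    {y : ℝ → EuclideanSpace ℝ (Fin n)}
    (hy : ∀ t : ℝ, 0 ≤ t → HasDerivWithinAt y (φ (y t) t) (Ici 0) t)
    (hyX : ∀ t : ℝ, 0 ≤ t → y t ∈ closure X) {t : ℝ} (ht : 0 ≤ t) :
    HasDerivWithinAt (fun s => g (y s)) (fderivWithin ℝ g (closure X) (y t) (φ (y t) t))
      (Ici 0) t :=
  ((hg.differentiableOn one_ne_zero _ (hyX t ht)).hasFDerivWithinAt).comp_hasDerivWithinAt t
    (hy t ht) fun s hs => hyX s hs

/-- The negative part of a constraint function is uniformly Lipschitz along the paths of the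
flow. -/
theorem exists_lipschitz_negPart_path (hb : Bornology.IsBounded X)
    (hX : UniqueDiffOn ℝ (closure X)) (hg : ContDiffOn ℝ 1 g (closure X))
    (hφ : ContinuousOn (fun z : EuclideanSpace ℝ (Fin n) × ℝ => φ z.1 z.2)
      (closure X ×ˢ Ici (0 : ℝ))) (T : ℝ) :
    ∃ C : ℝ, 0 ≤ C ∧ ∀ y : ℝ → EuclideanSpace ℝ (Fin n),
      (∀ t : ℝ, 0 ≤ t → HasDerivWithinAt y (φ (y t) t) (Ici 0) t) →
      (∀ t : ℝ, 0 ≤ t → y t ∈ closure X) → ∀ s ∈ Icc 0 T, ∀ t ∈ Icc 0 T,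
        ‖max (-g (y t)) 0 - max (-g (y s)) 0‖ ≤ C * ‖t - s‖ := by
  have hD : ContinuousOn (fderivWithin ℝ g (closure X)) (closure X) :=
    hg.continuousOn_fderivWithin hX le_rfl
  have hK : IsCompact (closure X ×ˢ Icc 0 T) := hb.isCompact_closure.prod isCompact_Icc
  -- The bound on the derivative of `g` along `φ` comes from compactness alone, hence serves all
  -- paths at once.
  obtain ⟨C, hC⟩ := hK.exists_bound_of_continuousOn
    (f := fun z => fderivWithin ℝ g (closure X) z.1 (φ z.1 z.2))
    ((hD.comp continuousOn_fst fun z hz => hz.1).clm_apply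
      (hφ.mono (prod_mono le_rfl Icc_subset_Ici_self)))
  refine ⟨max C 0, le_max_right _ _, fun y hy hyX s hs t ht => ?_⟩
  have hlip := Convex.norm_image_sub_le_of_norm_hasDerivWithin_le (C := max C 0)
    (fun r hr => (hasDerivWithinAt_comp_path hg hy hyX (show 0 ≤ r from hr.1)).mono
      Icc_subset_Ici_self)
    (fun r hr => (hC (y r, r) ⟨hyX r hr.1, hr⟩).trans (le_max_left _ _)) (convex_Icc 0 T) hs ht
  refine le_trans ?_ hlip
  refine (abs_max_sub_max_le_abs _ _ _).trans_eq ?_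
  rw [Real.norm_eq_abs, ← abs_neg]
  congr 1
  ring

end Paths

/-! ### Evolution of the barrier functional -/

section ParticleFlow

variable {n : ℕ} {Ω : Type*} [MeasurableSpace Ω] {μ : Measure Ω} [IsProbabilityMeasure μ]
  {X : Set (EuclideanSpace ℝ (Fin n))} {g : EuclideanSpace ℝ (Fin n) → ℝ}
  {φ : EuclideanSpace ℝ (Fin n) → ℝ → EuclideanSpace ℝ (Fin n)}
  {x : ℝ → Ω → EuclideanSpace ℝ (Fin n)} {q : ℝ → EuclideanSpace ℝ (Fin n) → ℝ}

/-- The exceptional null set depends on the time, so membership in `X` is taken at rational times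
only; right continuity of the paths extends it to all times, at the price of the closure. -/
theorem ae_forall_mem_closure (hXm : MeasurableSet X) (hx : IsParticleFlow μ φ x)
    (hq : ∀ t : ℝ, 0 ≤ t → IsPDFOf μ (x t) (q t)) (hqX : ∀ t : ℝ, 0 ≤ t → q t ∈ densities X) :
    ∀ᵐ ω ∂μ, ∀ t : ℝ, 0 ≤ t → x t ω ∈ closure X := by
  have hrat : ∀ᵐ ω ∂μ, ∀ r : ℚ, 0 ≤ r → x r ω ∈ X := by
    refine ae_all_iff.mpr fun r => ?_
    by_cases hr : 0 ≤ r
    · have hr' : (0 : ℝ) ≤ r := by exact_mod_cast hr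
      filter_upwards [((hq r hr').mem_densities_iff hXm).mp (hqX r hr')] with ω h _ using h
    · exact ae_of_all _ fun ω h => absurd h hr
  filter_upwards [hrat, hx] with ω hω hxω t ht
  have hcont : ContinuousWithinAt (fun s => x s ω) (Ioi t) t :=
    (hxω t ht).continuousWithinAt.mono fun s hs => ht.trans (le_of_lt hs)
  refine mem_closure_iff_frequently.mpr ?_
  refine hcont.tendsto.frequently ?_
  rw [frequently_nhdsWithin_iff]
  refine mem_closure_iff_frequently.mp (mem_closure_iff_nhds_basis Metric.nhds_basis_ball |>.mpr ?_)
  intro ε hε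
  obtain ⟨r, hr1, hr2⟩ := exists_rat_btwn (show t < t + ε by linarith)
  refine ⟨r, ⟨hω r (by exact_mod_cast ht.trans hr1.le), hr1⟩, ?_⟩
  rw [Metric.mem_ball, Real.dist_eq, abs_of_pos (by linarith)]
  linarith

/-- Since `g` is controlled only on `X`, the negative part is replaced by an indicator function on
the whole space, which agrees with it at `Y ω` almost surely. -/
theorem aestronglyMeasurable_negPart_and_barrier_eq (hXm : MeasurableSet X)
    (hg : ContinuousOn g X) {Y : Ω → EuclideanSpace ℝ (Fin n)}
    {p : EuclideanSpace ℝ (Fin n) → ℝ} (hp : IsPDFOf μ Y p) (hpX : p ∈ densities X) :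
    AEStronglyMeasurable (fun ω => max (-g (Y ω)) 0) μ ∧
      barrier X g p = ∫ ω, max (-g (Y ω)) 0 ∂μ := by
  have hS := measurableSet_constraintSet hXm hg
  set f := (X \ constraintSet X g).indicator (fun y => -g y) with hf
  have hfm : AEStronglyMeasurable f volume := by
    rw [hf, aestronglyMeasurable_indicator_iff (hXm.diff hS)]
    exact (hg.mono sdiff_subset).neg.aestronglyMeasurable (hXm.diff hS)
  have hae : (fun ω => f (Y ω)) =ᵐ[μ] fun ω => max (-g (Y ω)) 0 := by
    filter_upwards [(hp.mem_densities_iff hXm).mp hpX] with ω hω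
    rcases lt_or_ge (g (Y ω)) 0 with h | h
    · rw [hf, indicator_of_mem (show Y ω ∈ X \ constraintSet X g from
        ⟨hω, fun hc => not_le.mpr h hc.2⟩), max_eq_left (by linarith)]
    · rw [hf, indicator_of_notMem (fun hc => hc.2 ⟨hω, h⟩), max_eq_right (by linarith)]
  refine ⟨((hfm.mono_ac hp.map_absolutelyContinuous).comp_aemeasurable hp.1).congr hae, ?_⟩
  rw [← integral_congr_ae hae, hp.integral_comp hfm, barrier, ← integral_neg,
    ← integral_indicator (hXm.diff hS)]
  refine integral_congr_ae (ae_of_all _ fun y => ?_)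
  by_cases hy : y ∈ X \ constraintSet X g
  · simp only [hf, indicator_of_mem hy]; ring
  · simp only [hf, indicator_of_notMem hy, mul_zero]

theorem integrable_negPart (hXm : MeasurableSet X) (hb : Bornology.IsBounded X)
    (hg : ContinuousOn g (closure X)) {Y : Ω → EuclideanSpace ℝ (Fin n)}
    {p : EuclideanSpace ℝ (Fin n) → ℝ} (hp : IsPDFOf μ Y p) (hpX : p ∈ densities X) :
    Integrable (fun ω => max (-g (Y ω)) 0) μ := by
  obtain ⟨C, hC⟩ := hb.isCompact_closure.exists_bound_of_continuousOn hg
  refine Integrable.of_bound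
    (aestronglyMeasurable_negPart_and_barrier_eq hXm (hg.mono subset_closure) hp hpX).1 C ?_
  filter_upwards [(hp.mem_densities_iff hXm).mp hpX] with ω hω
  have := hC _ (subset_closure hω)
  rw [Real.norm_of_nonneg (le_max_right _ _)]
  exact max_le ((neg_le_abs _).trans this) ((norm_nonneg _).trans this)

/-- The barrier functional is continuous in time. -/
theorem continuousOn_barrier (hXm : MeasurableSet X) (hb : Bornology.IsBounded X)
    (hX : UniqueDiffOn ℝ (closure X)) (hg : ContDiffOn ℝ 1 g (closure X))
    (hφ : ContinuousOn (fun z : EuclideanSpace ℝ (Fin n) × ℝ => φ z.1 z.2)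
      (closure X ×ˢ Ici (0 : ℝ))) (hx : IsParticleFlow μ φ x)
    (hq : ∀ t : ℝ, 0 ≤ t → IsPDFOf μ (x t) (q t)) (hqX : ∀ t : ℝ, 0 ≤ t → q t ∈ densities X)
    (T : ℝ) : ContinuousOn (fun t => barrier X g (q t)) (Icc 0 T) := by
  obtain ⟨C, hC0, hC⟩ := exists_lipschitz_negPart_path hb hX hg hφ T
  have hgX := hg.continuousOn
  refine (LipschitzOnWith.of_dist_le_mul (K := ⟨C, hC0⟩) fun t ht s hs => ?_).continuousOn
  rw [dist_eq_norm, dist_eq_norm,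
    (aestronglyMeasurable_negPart_and_barrier_eq hXm (hgX.mono subset_closure) (hq t ht.1)
      (hqX t ht.1)).2,
    (aestronglyMeasurable_negPart_and_barrier_eq hXm (hgX.mono subset_closure) (hq s hs.1)
      (hqX s hs.1)).2,
    ← integral_sub (integrable_negPart hXm hb hgX (hq t ht.1) (hqX t ht.1))
      (integrable_negPart hXm hb hgX (hq s hs.1) (hqX s hs.1))]
  refine (norm_integral_le_of_norm_le_const (C := C * ‖t - s‖) ?_).trans_eq
    (by rw [probReal_univ, mul_one]; rfl)
  filter_upwards [hx, ae_forall_mem_closure hXm hx hq hqX] with ω hω hωX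
  exact hC (fun r => x r ω) hω hωX s hs t ht

/-- The right derivative of the barrier functional along the flow. -/
theorem hasDerivWithinAt_barrier (hXm : MeasurableSet X) (hb : Bornology.IsBounded X)
    (hX : ∀ y ∈ frontier X, ∃ ν, IsOutwardUnitNormal X y ν)
    (hg : ContDiffOn ℝ 1 g (closure X))
    (hφ : ContinuousOn (fun z : EuclideanSpace ℝ (Fin n) × ℝ => φ z.1 z.2)
      (closure X ×ˢ Ici (0 : ℝ))) (hx : IsParticleFlow μ φ x)
    (hq : ∀ t : ℝ, 0 ≤ t → IsPDFOf μ (x t) (q t)) (hqX : ∀ t : ℝ, 0 ≤ t → q t ∈ densities X)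
    {t : ℝ} (ht : 0 ≤ t) :
    HasDerivWithinAt (fun s => barrier X g (q s))
      (-∫ y in X \ constraintSet X g, q t y * inner ℝ (gradient g y) (φ y t)) (Ici t) t := by
  have hUD := uniqueDiffOn_closure hX
  have hgX := hg.continuousOn
  have hgX' := hgX.mono (subset_closure (s := X))
  have hS := measurableSet_constraintSet hXm hgX'
  have hD : ContinuousOn (fderivWithin ℝ g (closure X)) (closure X) :=
    hg.continuousOn_fderivWithin hUD le_rfl
  obtain ⟨C, hC0, hC⟩ := exists_lipschitz_negPart_path hb hUD hg hφ (t + 1)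
  have hpaths := ae_forall_mem_closure hXm hx hq hqX
  have hmemX := ((hq t ht).mem_densities_iff hXm).mp (hqX t ht)
  set G : EuclideanSpace ℝ (Fin n) → ℝ := (X \ constraintSet X g).indicator
    (fun y => -fderivWithin ℝ g (closure X) y (φ y t)) with hG
  have hGm : AEStronglyMeasurable G volume := by
    rw [hG, aestronglyMeasurable_indicator_iff (hXm.diff hS)]
    refine ContinuousOn.aestronglyMeasurable ?_ (hXm.diff hS)
    refine ((hD.mono (sdiff_subset.trans subset_closure)).clm_apply ?_).neg
    exact hφ.comp (f := fun y => (y, t)) (by fun_prop) fun y hy => ⟨subset_closure hy.1, ht⟩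
  -- `gradient g` and `fderivWithin` agree at interior points of the closure, hence almost
  -- everywhere on `X`, as the frontier is null.
  have hval : -∫ y in X \ constraintSet X g, q t y * inner ℝ (gradient g y) (φ y t) =
      ∫ ω, G (x t ω) ∂μ := by
    rw [(hq t ht).integral_comp hGm, ← integral_neg, ← integral_indicator (hXm.diff hS)]
    refine integral_congr_ae ?_
    filter_upwards [measure_eq_zero_iff_ae_notMem.mp (volume_frontier_eq_zero hX)] with y hyF
    by_cases hy : y ∈ X \ constraintSet X g
    · have hnhds : closure X ∈ 𝓝 y := by
        refine mem_of_superset (mem_interior_iff_mem_nhds.mp ?_) subset_closure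
        by_contra hc
        exact hyF ⟨subset_closure hy.1, hc⟩
      simp only [hG, indicator_of_mem hy, gradient, InnerProductSpace.toDual_symm_apply,
        fderivWithin_of_mem_nhds hnhds]
      ring
    · simp only [hG, indicator_of_notMem hy, mul_zero]
  have hcrit : ∀ᵐ y, y ∈ X → g y = 0 → fderivWithin ℝ g (closure X) y = 0 := by
    have hZ : MeasurableSet {y | y ∈ X ∧ g y = 0} := by
      have : {y | y ∈ X ∧ g y = 0} = constraintSet X g ∩ constraintSet X (-g) := by
        ext y
        simp only [constraintSet, mem_ofPred_eq, mem_inter_iff, Pi.neg_apply]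
        constructor
        · rintro ⟨h1, h2⟩
          exact ⟨⟨h1, h2.ge⟩, h1, by linarith⟩
        · rintro ⟨⟨h1, h2⟩, -, h3⟩
          exact ⟨h1, by linarith⟩
      rw [this]
      exact hS.inter (measurableSet_constraintSet hXm hgX'.neg)
    filter_upwards [ae_fderiv_eq_zero_of_zero_set volume hZ (fun y hy => hy.2) fun y hy =>
      ((hg.differentiableOn one_ne_zero y (subset_closure hy.1)).hasFDerivWithinAt).mono
        fun z hz => subset_closure hz.1] with y hy h1 h2 using hy ⟨h1, h2⟩
  have hnear : ∀ᶠ s in 𝓝[>] t, s ∈ Ioo t (t + 1) := Ioo_mem_nhdsGT (by linarith)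
  rw [← hasDerivWithinAt_Ioi_iff_Ici, hasDerivWithinAt_iff_tendsto_slope' self_notMem_Ioi, hval]
  -- Difference quotients over `(t, t + 1)` are dominated by the Lipschitz constant `C` for the
  -- horizon `t + 1`.
  have hlim := tendsto_integral_filter_of_dominated_convergence (μ := μ) (l := 𝓝[>] t)
    (F := fun s ω => (s - t)⁻¹ * (max (-g (x s ω)) 0 - max (-g (x t ω)) 0))
    (f := fun ω => G (x t ω)) (fun _ => C) ?_ ?_ (integrable_const C) ?_
  · refine hlim.congr' ?_
    filter_upwards [hnear] with s hs
    have hs0 := ht.trans hs.1.le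
    rw [integral_const_mul, integral_sub (integrable_negPart hXm hb hgX (hq s hs0) (hqX s hs0))
      (integrable_negPart hXm hb hgX (hq t ht) (hqX t ht)),
      ← (aestronglyMeasurable_negPart_and_barrier_eq hXm hgX' (hq s hs0) (hqX s hs0)).2,
      ← (aestronglyMeasurable_negPart_and_barrier_eq hXm hgX' (hq t ht) (hqX t ht)).2,
      slope_def_field, div_eq_inv_mul]
  · filter_upwards [hnear] with s hs
    have hs0 := ht.trans hs.1.le
    exact ((integrable_negPart hXm hb hgX (hq s hs0) (hqX s hs0)).sub
      (integrable_negPart hXm hb hgX (hq t ht) (hqX t ht))).aestronglyMeasurable.const_mul _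
  · filter_upwards [hnear] with s hs
    filter_upwards [hx, hpaths] with ω hω hωX
    have hpos : 0 < s - t := by linarith [hs.1]
    have := hC (fun r => x r ω) hω hωX t ⟨ht, by linarith⟩ s ⟨ht.trans hs.1.le, hs.2.le⟩
    rw [Real.norm_of_nonneg hpos.le] at this
    rw [norm_mul, norm_inv, Real.norm_of_nonneg hpos.le, inv_mul_le_iff₀ hpos, mul_comm]
    exact this
  -- Absolute continuity of the law of `x t` transfers `hcrit` to almost every path, which supplies
  -- the hypothesis at `g = 0` needed to differentiate the negative part.
  · filter_upwards [hx, hpaths, hmemX, (hq t ht).ae_of_ae hcrit] with ω hω hωX hωt hωc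
    have hder := (hasDerivWithinAt_comp_path hg hω hωX ht).mono (Ioi_subset_Ici ht)
    have hneg := hasDerivWithinAt_negPart hder fun h0 => by
      rw [hωc hωt h0, zero_apply]
    rw [hasDerivWithinAt_iff_tendsto_slope' self_notMem_Ioi] at hneg
    have hGv : G (x t ω) = if g (x t ω) < 0 then
        -fderivWithin ℝ g (closure X) (x t ω) (φ (x t ω) t) else 0 := by
      split_ifs with h
      · rw [hG, indicator_of_mem (show x t ω ∈ X \ constraintSet X g from
          ⟨hωt, fun hc => not_le.mpr h hc.2⟩)]
      · rw [hG, indicator_of_notMem fun hc => hc.2 ⟨hωt, not_lt.mp h⟩]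
    rw [hGv]
    refine hneg.congr fun s => ?_
    rw [slope_def_field, div_eq_inv_mul]

/-- Exponential decay of the barrier functional under the barrier condition on the drift. -/
theorem barrier_le_exp_mul (hXm : MeasurableSet X) (hb : Bornology.IsBounded X)
    (hX : ∀ y ∈ frontier X, ∃ ν, IsOutwardUnitNormal X y ν)
    (hg : ContDiffOn ℝ 1 g (closure X))
    (hφ : ContinuousOn (fun z : EuclideanSpace ℝ (Fin n) × ℝ => φ z.1 z.2)
      (closure X ×ˢ Ici (0 : ℝ))) (hx : IsParticleFlow μ φ x)
    (hq : ∀ t : ℝ, 0 ≤ t → IsPDFOf μ (x t) (q t)) (hqX : ∀ t : ℝ, 0 ≤ t → q t ∈ densities X)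
    {α : ℝ} (hα : ∀ t : ℝ, 0 ≤ t → α * barrier X g (q t) ≤
      ∫ y in X \ constraintSet X g, q t y * inner ℝ (gradient g y) (φ y t))
    {t₀ t : ℝ} (ht₀ : 0 ≤ t₀) (ht : t₀ ≤ t) :
    barrier X g (q t) ≤ Real.exp (-α * (t - t₀)) * barrier X g (q t₀) := by
  have := le_gronwallBound_of_liminf_deriv_right_le (f := fun s => barrier X g (q s))
    (f' := fun s =>
      -∫ y in X \ constraintSet X g, q s y * inner ℝ (gradient g y) (φ y s))
    (δ := barrier X g (q t₀)) (K := -α) (ε := 0) (a := t₀) (b := t)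
    ((continuousOn_barrier hXm hb (uniqueDiffOn_closure hX) hg hφ hx hq hqX t).mono
      (Icc_subset_Icc_left ht₀))
    (fun s hs r hr => by
      have h := (hasDerivWithinAt_barrier hXm hb hX hg hφ hx hq hqX
        (ht₀.trans hs.1)).liminf_right_slope_le hr
      simpa only [slope_def_field, div_eq_inv_mul] using h)
    le_rfl (fun s hs => by linarith [hα s (ht₀.trans hs.1)]) t ⟨ht, le_rfl⟩
  rwa [gronwallBound_ε0, mul_comm] at this

end ParticleFlow

end SafeParticleFlow

/-! ### The safe particle flow theorem -/

theorem mainTheorem1 {n N : ℕ} {Ω : Type*} [MeasurableSpace Ω]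
    (μ : Measure Ω) [IsProbabilityMeasure μ]
    -- the bounded state space, with an outward unit normal at every boundary point
    (X : Set (EuclideanSpace ℝ (Fin n)))
    (hXmeas : MeasurableSet X) (hXbdd : Bornology.IsBounded X)
    (hXnormal : ∀ y ∈ frontier X, ∃ ν, SafeParticleFlow.IsOutwardUnitNormal X y ν)
    -- the constraint functions, continuously differentiable up to the boundary
    (g : Fin N → EuclideanSpace ℝ (Fin n) → ℝ)
    (hg : ∀ i, ContDiffOn ℝ 1 (g i) (closure X))
    (hS : (SafeParticleFlow.safeSet X g).Nonempty)
    -- the particle drift, tangent to the boundary of the state space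
    (φ : EuclideanSpace ℝ (Fin n) → ℝ → EuclideanSpace ℝ (Fin n))
    (hφcont : ContinuousOn (fun z : EuclideanSpace ℝ (Fin n) × ℝ => φ z.1 z.2)
      (closure X ×ˢ Ici (0 : ℝ)))
    (hφtan : ∀ t : ℝ, 0 ≤ t → ∀ y ∈ frontier X, ∀ ν,
      SafeParticleFlow.IsOutwardUnitNormal X y ν → inner ℝ (φ y t) ν = 0)
    -- the particle flow and its density
    (x : ℝ → Ω → EuclideanSpace ℝ (Fin n))
    (hx : SafeParticleFlow.IsParticleFlow μ φ x)
    (q : ℝ → EuclideanSpace ℝ (Fin n) → ℝ)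
    (hq : ∀ t : ℝ, 0 ≤ t → SafeParticleFlow.IsPDFOf μ (x t) (q t))
    (hq0 : q 0 ∈ SafeParticleFlow.densities X)
    -- the barrier condition on the drift
    (αh : ℝ) (hαh : 0 < αh)
    (hcbc : ∀ t : ℝ, 0 ≤ t → ∀ i,
      αh * SafeParticleFlow.barrier X (g i) (q t) ≤
        ∫ y in X \ SafeParticleFlow.constraintSet X (g i),
          q t y * inner ℝ (gradient (g i) y) (φ y t)) :
    -- the barrier functional is nonnegative and its zero set is the feasible set
    (∀ p ∈ SafeParticleFlow.densities X,
      (∀ i, 0 ≤ SafeParticleFlow.barrier X (g i) p) ∧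
      ((∀ i, SafeParticleFlow.barrier X (g i) p = 0) ↔
        p ∈ SafeParticleFlow.feasibleDensities X g)) ∧
    -- for a drift that is Lipschitz in space, the density remains a density on the state space
    ((∀ T : ℝ, ∃ L : NNReal, ∀ t ∈ Icc 0 T, LipschitzOnWith L (fun y => φ y t) (closure X)) →
      ∀ t : ℝ, 0 ≤ t → q t ∈ SafeParticleFlow.densities X) ∧
    -- forward invariance and exponential stability, for a flow of densities on the state space
    ((∀ t : ℝ, 0 ≤ t → q t ∈ SafeParticleFlow.densities X) →
      (∀ t₀ : ℝ, 0 ≤ t₀ → q t₀ ∈ SafeParticleFlow.feasibleDensities X g →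
        ∀ t : ℝ, t₀ ≤ t → q t ∈ SafeParticleFlow.feasibleDensities X g) ∧
      (∀ t₀ : ℝ, 0 ≤ t₀ → ∀ t : ℝ, t₀ ≤ t → ∀ i,
        SafeParticleFlow.barrier X (g i) (q t) ≤
          Real.exp (-αh * (t - t₀)) * SafeParticleFlow.barrier X (g i) (q t₀))) := by
  have hgc : ∀ i, ContinuousOn (g i) (closure X) := fun i => (hg i).continuousOn
  have hpos : ∀ p ∈ SafeParticleFlow.densities X,
      ∀ i, 0 ≤ SafeParticleFlow.barrier X (g i) p := fun p hp i =>
    SafeParticleFlow.barrier_nonneg hXmeas ((hgc i).mono subset_closure) hp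
  have hiff : ∀ p ∈ SafeParticleFlow.densities X,
      ((∀ i, SafeParticleFlow.barrier X (g i) p = 0) ↔
        p ∈ SafeParticleFlow.feasibleDensities X g) := fun p hp =>
    SafeParticleFlow.barrier_eq_zero_iff_mem_feasibleDensities hXmeas hXbdd hgc hp
  refine ⟨fun p hp => ⟨hpos p hp, hiff p hp⟩, fun hL t ht => ?_, fun hqX => ?_⟩
  -- The initial law has a density, so paths almost surely start off the null frontier, hence in the
  -- interior.
  · have hnull := measure_eq_zero_iff_ae_notMem.mp
      (SafeParticleFlow.volume_frontier_eq_zero hXnormal)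
    rw [(hq t ht).mem_densities_iff hXmeas]
    filter_upwards [hx, ((hq 0 le_rfl).mem_densities_iff hXmeas).mp hq0,
      (hq 0 le_rfl).ae_of_ae hnull] with ω hω h0 h0F
    refine interior_subset
      (SafeParticleFlow.mem_interior_of_flow hXnormal hφtan hL hω ?_ ht)
    by_contra hc
    exact h0F ⟨subset_closure h0, hc⟩
  · have hdecay : ∀ t₀ : ℝ, 0 ≤ t₀ → ∀ t : ℝ, t₀ ≤ t → ∀ i,
        SafeParticleFlow.barrier X (g i) (q t) ≤
          Real.exp (-αh * (t - t₀)) * SafeParticleFlow.barrier X (g i) (q t₀) :=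
      fun t₀ ht₀ t ht i => SafeParticleFlow.barrier_le_exp_mul hXmeas hXbdd hXnormal (hg i)
        hφcont hx hq hqX (fun s hs => hcbc s hs i) ht₀ ht
    refine ⟨fun t₀ ht₀ hfeas t ht => ?_, hdecay⟩
    refine (hiff _ (hqX t (ht₀.trans ht))).mp fun i => ?_
    refine le_antisymm ?_ (hpos _ (hqX t (ht₀.trans ht)) i)
    simpa only [(hiff _ (hqX t₀ ht₀)).mpr hfeas i, mul_zero] using hdecay t₀ ht₀ t ht i
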